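/- Let $X$ be a proper CAT(0) space with visual boundary $\partial_\infty X$ (asymptoty classes of geodesic rays), and let $G$ be a group acting on $X$ properly discontinuously and cocompactly by isometries. For $h\subseteq X$ put $h^*=X\smallsetminus\overline{h}$ and $W(h)=\overline{h}\cap\overline{h^*}$. A halfspace is an open convex set $h$ such that $h^*$ is convex ($\varnothing$ and $X$ are the trivial halfspaces). Let $\mathcal H$ be a $G$-invariant halfspace system: a family of halfspaces containing $\varnothing$ and $X$, on which $h\mapsto h^*$ is an involution, such that every point of $X$ has a neighbourhood meeting only finitely many walls $W(h)$, $h\in\mathcal H$, and such that there is no infinite subfamily whose members are pairwise transverse (i.e. none of $h\subseteq k$, $h^*\subseteq k$, $h\subseteq k^*$, $h^*\subseteq k^*$ holds). An ultrafilter on $\mathcal H$ is a set $\sigma\subseteq\mathcal H$ containing exactly one of $h,h^*$ for each $h\in\mathcal H$ and with no $h,k\in\sigma$ such that $h\subseteq k^*$. It is principal if every descending sequence in $\sigma$ is eventually constant. Two ultrafilters are almost equal if their symmetric difference is finite. The Roller boundary $\Re\mathcal H$ is the set of almost-equality classes, ordered by $\Sigma_1\le\Sigma_2$ iff $\Sigma_2$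 meets the closure of $\Sigma_1$ (in the topology induced from the product topology on $2^{\mathcal H}$). Let $\Pi$ denote the class of the principal ultrafilters. For a closed convex $C\subseteq X$ let $\partial_\infty C$ be the set of endpoints of geodesic rays contained in $C$. For $\xi\in\partial_\infty X$ let $\Re(\xi)$ be the set of classes of ultrafilters $\sigma$ with $\xi\in\partial_\infty\overline{h}$ for all $h\in\sigma$, and let $\rho(\xi)$ be the minimum element of $\Re(\xi)$. The angular metric on $\partial_\infty X$ is $\angle(\xi,\eta)=\sup_{x\in X}\angle_x(\xi,\eta)$, where $\angle_x(\xi,\eta)$ is the Alexandrov angle at $x$ between the rays from $x$ to $\xi$ and to $\eta$; a set $A\subseteq\partial_\infty X$ is $\pi$-discrete if $\angle(\xi,\eta)\ge\pi$ for all distinct $\xi,\eta\in A$. Suppose $\rho^{-1}(\Pi)=\varnothing$. Then: 1. $\rho$ is well defined, that is, $\rho(\xi)$ is the least element of $\Re(\xi)$ for every $\xi\in\partial_\infty X$; 2. for every geodesic line $c:\mathbb R\to X$, the classes $\rho(c(\infty))$ and $\rho(c(-\infty))$ are incomparable in $\Re\mathcal H$; 3. for every $A\subseteq\partial_\infty X$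 that is $\pi$-discrete in the angular metric, the restriction of $\rho$ to $A$ is injective. -/

import Mathlib

open Set Filter Topology
open scoped NNReal Pointwise

namespace CatZero

/-! ### Poc-sets, ultrafilters and the Roller boundary -/

/-- A poc-set: a partially ordered set with minimum `⊥` and an order-reversing involution
`star` such that `a ≤ star a` only for `a = ⊥`. -/
class PocSet (H : Type*) extends PartialOrder H, OrderBot H where
  star : H → H
  star_star : ∀ a : H, star (star a) = a
  star_le_star : ∀ a b : H, a ≤ b → star b ≤ star a
  eq_bot_of_le_star : ∀ a : H, a ≤ star a → a = ⊥

/-- `S` satisfies (UF2): no relation `h ≤ k*` holds for `h, k ∈ S`. -/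
def IsFilterBase {H : Type*} [PocSet H] (S : Set H) : Prop :=
  ∀ h ∈ S, ∀ k ∈ S, ¬ h ≤ PocSet.star k

/-- Ultrafilters on a poc-set `H`; the type `PocUltrafilter H` is the space `H°`. -/
@[ext]
structure PocUltrafilter (H : Type*) [PocSet H] where
  carrier : Set H
  mem_xor : ∀ h : H, Xor (h ∈ carrier) (PocSet.star h ∈ carrier)
  isFilterBase : IsFilterBase carrier

section Roller

variable {H : Type*} [PocSet H]

/-- An ultrafilter is principal if it satisfies the descending chain condition. -/
def PocUltrafilter.IsPrincipal (σ : PocUltrafilter H) : Prop :=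
  ∀ h : ℕ → H, (∀ n, h n ∈ σ.carrier) → (∀ n, h (n + 1) ≤ h n) →
    ∃ N, ∀ n ≥ N, h (n + 1) = h n

open scoped Classical in
/-- The Tychonoff topology, induced from the product topology on `2 ^ H` with `2` discrete. -/
noncomputable instance : TopologicalSpace (PocUltrafilter H) :=
  TopologicalSpace.induced (fun σ (h : H) => (decide (h ∈ σ.carrier) : Bool)) inferInstance

/-- Almost-equality: the symmetric difference is finite. -/
instance almostEqual (H : Type*) [PocSet H] : Setoid (PocUltrafilter H) where
  r σ τ := (symmDiff σ.carrier τ.carrier).Finite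
  iseqv :=
    { refl := fun σ => by simp
      symm := fun {σ τ} h => by rwa [symmDiff_comm]
      trans := fun {σ τ υ} h₁ h₂ =>
        (h₁.union h₂).subset (symmDiff_triangle σ.carrier τ.carrier υ.carrier) }

/-- The Roller boundary `ℜH`: the set of almost-equality classes of ultrafilters. -/
def RollerBoundary (H : Type*) [PocSet H] : Type _ := Quotient (almostEqual H)

/-- The almost-equality class of an ultrafilter. -/
def PocUltrafilter.toClass (σ : PocUltrafilter H) : RollerBoundary H :=
  Quotient.mk (almostEqual H) σ

/-- The ultrafilters belonging to an almost-equality class. -/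
def RollerBoundary.elements (S : RollerBoundary H) : Set (PocUltrafilter H) :=
  {σ | σ.toClass = S}

/-- The order of the Roller boundary: `S₁ ≤ S₂` iff `S₂` meets the closure of `S₁`. -/
instance : LE (RollerBoundary H) where
  le S₁ S₂ := (S₂.elements ∩ closure S₁.elements).Nonempty

/-- `S` is the principal class `Π`, the almost-equality class of the principal ultrafilters. -/
def RollerBoundary.IsPrincipalClass (S : RollerBoundary H) : Prop :=
  ∃ σ ∈ S.elements, σ.IsPrincipal

/-- A non-trivial poc-set carries an ultrafilter. -/
theorem nonempty_pocUltrafilter (hne : ∃ a : H, a ≠ ⊥) : Nonempty (PocUltrafilter H) := by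
  have hstar : ∀ a b : H, a ≤ PocSet.star b → b ≤ PocSet.star a := fun a b h => by
    have := PocSet.star_le_star _ _ h
    rwa [PocSet.star_star] at this
  obtain ⟨M, hM⟩ : ∃ M : Set H, Maximal (fun S => S ∈ {S : Set H | IsFilterBase S}) M := by
    refine zorn_subset _ fun c hc hchain => ⟨⋃₀ c, ?_, fun s hs => subset_sUnion_of_mem hs⟩
    rintro h ⟨s, hs, hhs⟩ k ⟨t, ht, hkt⟩
    rcases hchain.total hs ht with hst | hts
    · exact hc ht h (hst hhs) k hkt
    · exact hc hs h hhs k (hts hkt)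
  have hbase : IsFilterBase M := hM.prop
  have key : ∀ h : H, h ∉ M → h = ⊥ ∨ ∃ k ∈ M, h ≤ PocSet.star k := by
    intro h hh
    by_contra hcon
    push Not at hcon
    obtain ⟨h0, hk⟩ := hcon
    have hins : IsFilterBase (insert h M) := by
      rintro a (rfl | ha) b (rfl | hb) hab
      · exact h0 (PocSet.eq_bot_of_le_star _ hab)
      · exact hk b hb hab
      · exact hk a ha (hstar _ _ hab)
      · exact hbase a ha b hb hab
    exact hh (hM.le_of_ge hins (subset_insert h M) (mem_insert h M))
  have hbot : ∀ k ∈ M, k ≠ ⊥ := fun k hk h0 => hbase k hk k hk (by rw [h0]; exact bot_le)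
  have htop : PocSet.star (⊥ : H) ∈ M := by
    by_contra hn
    rcases key _ hn with h | ⟨k, hk, h⟩
    · obtain ⟨a, ha⟩ := hne
      refine ha (le_bot_iff.1 ?_)
      have := PocSet.star_le_star _ _ (bot_le : ⊥ ≤ PocSet.star a)
      rwa [PocSet.star_star, h] at this
    · exact hbot k hk (le_bot_iff.1 (by simpa [PocSet.star_star] using hstar _ _ h))
  refine ⟨⟨M, fun h => ?_, hbase⟩⟩
  by_cases h1 : h ∈ M
  · refine Or.inl ⟨h1, fun h2 => hbase h h1 _ h2 ?_⟩
    rw [PocSet.star_star]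
  · refine Or.inr ⟨?_, h1⟩
    by_contra h2
    rcases key h h1 with rfl | ⟨k, hk, hhk⟩
    · exact h2 htop
    rcases key _ h2 with h0 | ⟨l, hl, hhl⟩
    · refine h1 ?_
      have : h = PocSet.star ⊥ := by rw [← h0, PocSet.star_star]
      rwa [this]
    · have h3 : l ≤ h := by simpa [PocSet.star_star] using hstar _ _ hhl
      exact hbase l hl k hk (h3.trans hhk)

end Roller

/-! ### CAT(0) spaces -/

/-- CAT(0) spaces: geodesic spaces in which geodesic triangles are not fatter than their
Euclidean comparison triangles. The comparison is stated for a vertex `p` and a point `z` of the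
opposite side `[x, y]`, with the Euclidean distance computed by Stewart's formula. -/
structure IsCAT0 (X : Type*) [MetricSpace X] : Prop where
  exists_geodesic : ∀ x y : X, ∃ γ : ℝ → X, γ 0 = x ∧ γ (dist x y) = y ∧
    ∀ s ∈ Icc 0 (dist x y), ∀ t ∈ Icc 0 (dist x y), dist (γ s) (γ t) = |s - t|
  comparison : ∀ p x y z : X, ∀ t ∈ Icc (0 : ℝ) 1,
    dist x z = t * dist x y → dist z y = (1 - t) * dist x y →
    dist p z ^ 2 ≤ (1 - t) * dist p x ^ 2 + t * dist p y ^ 2 - t * (1 - t) * dist x y ^ 2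

section Boundary

variable {X : Type*} [MetricSpace X]

/-- Geodesic convexity: `C` contains every point of every geodesic segment with endpoints
in `C` (`z` lies on a geodesic segment from `x` to `y` iff the stated equality holds). -/
def GeodConvex (C : Set X) : Prop :=
  ∀ x ∈ C, ∀ y ∈ C, ∀ z, dist x z + dist z y = dist x y → z ∈ C

/-- Geodesic rays `[0, ∞) → X`. -/
def GeodesicRay (X : Type*) [MetricSpace X] : Type _ := {c : ℝ≥0 → X // Isometry c}

/-- Two rays are asymptotic if they stay at bounded distance. -/
instance asymptotic (X : Type*) [MetricSpace X] : Setoid (GeodesicRay X) where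
  r c c' := ∃ K : ℝ, ∀ t, dist (c.1 t) (c'.1 t) ≤ K
  iseqv :=
    { refl := fun c => ⟨0, fun t => by simp⟩
      symm := fun {c c'} ⟨K, h⟩ => ⟨K, fun t => by rw [dist_comm]; exact h t⟩
      trans := fun {c c' c''} ⟨K, h⟩ ⟨L, h'⟩ =>
        ⟨K + L, fun t => (dist_triangle _ _ _).trans (add_le_add (h t) (h' t))⟩ }

/-- The visual boundary `∂∞X`: asymptoty classes of geodesic rays. -/
def VisualBoundary (X : Type*) [MetricSpace X] : Type _ := Quotient (asymptotic X)

/-- The endpoint `c(∞)` of a geodesic ray. -/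
def GeodesicRay.endpoint (c : GeodesicRay X) : VisualBoundary X := Quotient.mk (asymptotic X) c

/-- `∂∞C` as a subset of `∂∞X`, for a closed convex `C`: the endpoints of the rays in `C`. -/
def boundaryOf (C : Set X) : Set (VisualBoundary X) :=
  {ξ | ∃ c : GeodesicRay X, c.endpoint = ξ ∧ ∀ t, c.1 t ∈ C}

/-- The ray `t ↦ c t` of a geodesic line `c`. -/
def forwardRay (c : ℝ → X) (hc : Isometry c) : GeodesicRay X :=
  ⟨fun t => c t, hc.comp isometry_subtype_coe⟩

/-- The ray `t ↦ c (-t)` of a geodesic line `c`. -/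
def backwardRay (c : ℝ → X) (hc : Isometry c) : GeodesicRay X :=
  ⟨fun t => c (-t), hc.comp ((IsometryEquiv.neg ℝ).isometry.comp isometry_subtype_coe)⟩

/-- The angle at the vertex corresponding to `p` in a Euclidean comparison triangle for
`p, x, y`, where `x ≠ p ≠ y`. -/
noncomputable def comparisonAngle (p x y : X) : ℝ :=
  Real.arccos ((dist p x ^ 2 + dist p y ^ 2 - dist x y ^ 2) / (2 * dist p x * dist p y))

/-- The Alexandrov angle between two geodesic rays with a common origin. -/
noncomputable def alexandrovAngle (c c' : GeodesicRay X) : ℝ :=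
  limsup (fun q : ℝ≥0 × ℝ≥0 => comparisonAngle (c.1 0) (c.1 q.1) (c'.1 q.2))
    (𝓝[>] 0 ×ˢ 𝓝[>] 0)

/-- The angular metric `∠(ξ, η) = sup_x ∠_x(ξ, η)` on `∂∞X`, where `∠_x(ξ, η)` is the Alexandrov
angle between the rays from `x` to `ξ` and to `η`. -/
noncomputable def angularDist (ξ η : VisualBoundary X) : ℝ :=
  sSup {θ | ∃ c c' : GeodesicRay X, c.endpoint = ξ ∧ c'.endpoint = η ∧ c.1 0 = c'.1 0 ∧
    θ = alexandrovAngle c c'}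

/-- `A ⊆ ∂∞X` is `π`-discrete: distinct points of `A` have angular distance at least `π`. -/
def IsPiDiscrete (A : Set (VisualBoundary X)) : Prop :=
  A.Pairwise fun ξ η => Real.pi ≤ angularDist ξ η

end Boundary

/-! ### Halfspace systems -/

section Halfspaces

variable {X : Type*} [MetricSpace X]

/-- `h* = X ∖ cl h`. -/
def hstar (h : Set X) : Set X := (closure h)ᶜ

/-- The wall `W(h) = cl h ∩ cl h*`. -/
def wall (h : Set X) : Set X := closure h ∩ closure (hstar h)

/-- Halfspaces, including the trivial ones `∅` and `X`. -/
def IsHalfspace (h : Set X) : Prop := IsOpen h ∧ GeodConvex h ∧ GeodConvex (hstar h)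

/-- Transverse halfspaces: none of `h ≤ k`, `h* ≤ k`, `h ≤ k*`, `h* ≤ k*` holds. -/
def IsTransverse (h k : Set X) : Prop :=
  ¬ h ⊆ k ∧ ¬ hstar h ⊆ k ∧ ¬ h ⊆ hstar k ∧ ¬ hstar h ⊆ hstar k

end Halfspaces

/-- A halfspace system in `X`. The field `star_star` says that `h ↦ h*` is an involution of the
system, as it has to be in a poc-set. -/
structure HalfspaceSystem (X : Type*) [MetricSpace X] where
  carrier : Set (Set X)
  isHalfspace : ∀ h ∈ carrier, IsHalfspace h
  empty_mem : ∅ ∈ carrier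
  univ_mem : univ ∈ carrier
  star_mem : ∀ h ∈ carrier, hstar h ∈ carrier
  star_star : ∀ h ∈ carrier, hstar (hstar h) = h
  /-- (H1): every point has a neighbourhood meeting only finitely many walls. -/
  locally_finite : ∀ x : X, ∃ U ∈ 𝓝 x, {W | (∃ h ∈ carrier, W = wall h) ∧ (W ∩ U).Nonempty}.Finite
  /-- (H2): there is no infinite transverse subfamily. -/
  omega_dim : ∀ S ⊆ carrier, S.Pairwise IsTransverse → S.Finite

section System

variable {X : Type*} [MetricSpace X]

/-- A halfspace system is a poc-set under inclusion and `h ↦ h*`. -/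
instance (𝓗 : HalfspaceSystem X) : PocSet 𝓗.carrier where
  __ := (inferInstance : PartialOrder 𝓗.carrier)
  bot := ⟨∅, 𝓗.empty_mem⟩
  bot_le a := empty_subset a.1
  star a := ⟨hstar a.1, 𝓗.star_mem a.1 a.2⟩
  star_star a := Subtype.ext (𝓗.star_star a.1 a.2)
  star_le_star _ _ h := compl_subset_compl.2 (closure_mono h)
  eq_bot_of_le_star a h := by
    refine Subtype.ext (eq_empty_iff_forall_notMem.2 fun x hx => ?_)
    exact (show a.1 ⊆ hstar a.1 from h) hx (subset_closure hx)

/-- `𝓗^ξ`: the ultrafilters `σ` on `𝓗` such that `ξ ∈ ∂∞(cl h)` for all `h ∈ σ`. -/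
def HalfspaceSystem.ultrafiltersAt (𝓗 : HalfspaceSystem X) (ξ : VisualBoundary X) :
    Set (PocUltrafilter 𝓗.carrier) :=
  {σ | ∀ h ∈ σ.carrier, ξ ∈ boundaryOf (closure h.1)}

/-- `ℜ(ξ)`: the almost-equality classes represented in `𝓗^ξ`. -/
def HalfspaceSystem.classesAt (𝓗 : HalfspaceSystem X) (ξ : VisualBoundary X) :
    Set (RollerBoundary 𝓗.carrier) :=
  PocUltrafilter.toClass '' 𝓗.ultrafiltersAt ξ

theorem HalfspaceSystem.nonempty_roller (𝓗 : HalfspaceSystem X) (ξ : VisualBoundary X) :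
    Nonempty (RollerBoundary 𝓗.carrier) := by
  obtain ⟨c, -⟩ := Quotient.exists_rep ξ
  obtain ⟨σ⟩ := nonempty_pocUltrafilter (H := 𝓗.carrier)
    ⟨⟨univ, 𝓗.univ_mem⟩, fun h => by
      have h' : (univ : Set X) = ∅ := congrArg Subtype.val h
      exact (h' ▸ mem_univ (c.1 0) : c.1 0 ∈ (∅ : Set X))⟩
  exact ⟨σ.toClass⟩

/-- The boundary decomposition map `ρ : ∂∞X → ℜ𝓗`: `ρ(ξ)` is the minimum element of `ℜ(ξ)`. -/
noncomputable def HalfspaceSystem.rho (𝓗 : HalfspaceSystem X) (ξ : VisualBoundary X) :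
    RollerBoundary 𝓗.carrier :=
  @Classical.epsilon _ (𝓗.nonempty_roller ξ) fun S => IsLeast (𝓗.classesAt ξ) S

end System

end CatZero

open CatZero

/-!
Call a halfspace `h` *forced* by `ξ ∈ ∂∞X` if `ξ ∉ ∂∞(cl h*)`. Every ultrafilter at `ξ` contains the
halfspaces forced by `ξ`. Say that `h` *strongly separates* `ξ` from `η` if `h` is forced by `ξ` and
`h*` is forced by `η`.

*Existence of the minimum.* Only finitely many halfspaces separate two given points
(`HalfspaceSystem.finite_separating`). Fix a point `x` off all walls. The halfspaces forced by `ξ`,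
together with those halfspaces containing `x` that have `ξ` in the boundary of both sides, form an
ultrafilter at `ξ`. If `σ` is any ultrafilter at `ξ` and `f ∈ σ`, then the members of the first one
that are disjoint from `f` separate `x` from the points of `f`, so there are finitely many of them;
hence `σ` is a limit of finite modifications of the first one
(`PocUltrafilter.toClass_le_toClass`).

*Chains.* If `ρ(ξ)` is not principal, its ultrafilters contain a strictly descending chain. Such a
chain persists to all larger classes, in particular to the class of the ultrafilter above; since
only finitely many members of the chain can contain `x` or any other given point `y`, there is a
strictly descending chain of halfspaces forced by `ξ`, all of them away from `y`
(`HalfspaceSystem.exists_chain`).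

*Opposite rays.* Let `r`, `s` be the two halves of a geodesic line, and take a chain for `r(∞)` away
from `r(0)`. Along the line, the distance to a member `h` of the chain is a convex function that
vanishes far out on `r` and is positive at `r(0)`, so it grows along `s`
(`HalfspaceSystem.infDist_lt_of_opposite`). Along a ray ending in `∂∞(cl h)` it would not increase
(`infDist_le_of_endpoint_mem`). So the complements of the members of the chain are forced by `s(∞)`.
All ultrafilters in the closure of `ρ(r(∞))` contain the chain, while those at `s(∞)` avoid it, so
`ρ(r(∞)) ≰ ρ(s(∞))`.

*Discreteness.* If `∠(ξ, η) ≥ π`, there are points at which the rays to `ξ` and `η` make angles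
tending to `π`. Comparison angles are at least as large, so by cocompactness translates of these
pairs of rays converge to the two halves of a line (`exists_opposite_limit`). The halfspaces in a
chain for one end of the line strongly separate its ends, which is an open condition on the pair
of rays; hence `ξ` and `η` are strongly separated by arbitrarily many halfspaces, and ultrafilters
at `ξ` and at `η` have infinite symmetric difference (`HalfspaceSystem.rho_ne_rho`).
-/

namespace CatZero

/-! ### Ultrafilters and the order of the Roller boundary -/

section Poc

variable {H : Type*} [PocSet H]

theorem le_star_comm {a b : H} (h : a ≤ PocSet.star b) : b ≤ PocSet.star a := by
  simpa [PocSet.star_star] using PocSet.star_le_star _ _ h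

namespace PocUltrafilter

theorem star_mem_iff (σ : PocUltrafilter H) (h : H) :
    PocSet.star h ∈ σ.carrier ↔ h ∉ σ.carrier := by
  rcases σ.mem_xor h with ⟨h₁, h₂⟩ | ⟨h₁, h₂⟩ <;> simp [h₁, h₂]

theorem mem_of_le (σ : PocUltrafilter H) {a b : H} (ha : a ∈ σ.carrier) (hab : a ≤ b) :
    b ∈ σ.carrier := by
  by_contra hb
  refine σ.isFilterBase a ha _ ((σ.star_mem_iff b).2 hb) ?_
  rwa [PocSet.star_star]

theorem exists_strictAnti_of_not_isPrincipal {σ : PocUltrafilter H} (hσ : ¬ σ.IsPrincipal) :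
    ∃ k : ℕ → H, StrictAnti k ∧ ∀ n, k n ∈ σ.carrier := by
  simp only [IsPrincipal] at hσ
  push Not at hσ
  obtain ⟨h, hmem, hle, hne⟩ := hσ
  have hanti : Antitone h := antitone_nat_of_succ_le hle
  obtain ⟨φ, hφ, hP⟩ := extraction_of_frequently_atTop
    (P := fun n => h (n + 1) ≠ h n) (frequently_atTop.2 fun N => by
      obtain ⟨n, hn, h'⟩ := hne N
      exact ⟨n, hn, h'⟩)
  refine ⟨h ∘ φ, strictAnti_nat_of_succ_lt fun n => ?_, fun n => hmem _⟩
  exact (hanti (Nat.succ_le_of_lt (hφ n.lt_succ_self))).trans_lt (lt_of_le_of_ne (hle _) (hP n))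

theorem toClass_eq_iff {σ τ : PocUltrafilter H} :
    σ.toClass = τ.toClass ↔ (symmDiff σ.carrier τ.carrier).Finite :=
  Quotient.eq

/-- Ultrafilters are closed upwards, so one that contains a strictly descending chain up to
finitely many members contains all of it. -/
theorem mem_of_strictAnti_of_toClass_eq {σ τ : PocUltrafilter H} (h : σ.toClass = τ.toClass)
    {k : ℕ → H} (hk : StrictAnti k) (hmem : ∀ n, k n ∈ σ.carrier) (n : ℕ) :
    k n ∈ τ.carrier := by
  by_contra hn
  refine (infinite_range_of_injective (hk.injective.comp (add_right_injective n)))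
    ((toClass_eq_iff.1 h).subset ?_)
  rintro _ ⟨m, rfl⟩
  exact Or.inl ⟨hmem _, fun hm => hn (τ.mem_of_le hm (hk.antitone (Nat.le_add_right n m)))⟩

theorem isClosed_setOf_mem (h : H) : IsClosed {σ : PocUltrafilter H | h ∈ σ.carrier} := by
  classical
  refine isClosed_induced_iff.2 ⟨{f | f h = true}, ?_, ?_⟩
  · exact isClosed_eq (continuous_apply h) continuous_const
  · ext σ
    simp

/-- A strictly descending chain in one ultrafilter is contained in every ultrafilter of the
closure of its class: descending chains persist to larger classes of the Roller boundary. -/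
theorem mem_of_strictAnti_of_mem_closure {σ τ : PocUltrafilter H} {k : ℕ → H}
    (hk : StrictAnti k) (hmem : ∀ n, k n ∈ σ.carrier)
    (hτ : τ ∈ closure σ.toClass.elements) (n : ℕ) : k n ∈ τ.carrier := by
  refine (closure_minimal ?_ (isClosed_setOf_mem (k n))) hτ
  intro υ hυ
  exact mem_of_strictAnti_of_toClass_eq (Eq.symm hυ) hk hmem n

/-- In the induced product topology, approximation is agreement on finite sets. -/
theorem mem_closure_of_forall_finset {S : Set (PocUltrafilter H)} {σ : PocUltrafilter H}
    (h : ∀ F : Finset H, ∃ τ ∈ S, ∀ f ∈ F, f ∈ τ.carrier ↔ f ∈ σ.carrier) :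
    σ ∈ closure S := by
  classical
  refine mem_closure_iff.2 fun o ho hσ => ?_
  obtain ⟨o', ho', rfl⟩ := isOpen_induced_iff.1 ho
  obtain ⟨F, u, hu, hsub⟩ := isOpen_pi_iff.1 ho' _ hσ
  obtain ⟨τ, hτ, hF⟩ := h F
  refine ⟨τ, hsub fun f hf => ?_, hτ⟩
  have := (hu f hf).2
  have hiff := hF f hf
  simp only [hiff] at this ⊢
  convert this

/-- The ultrafilter obtained from `σ₀` by adding everything above some member of `F` and removing
the elements that this contradicts. The hypothesis that `F` lies in an ultrafilter `σ` makes the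
result consistent. -/
def modify (σ₀ σ : PocUltrafilter H) (F : Set H) (hF : F ⊆ σ.carrier) : PocUltrafilter H where
  carrier := {h | (∃ f ∈ F, f ≤ h) ∨ (h ∈ σ₀.carrier ∧ ∀ f ∈ F, ¬ h ≤ PocSet.star f)}
  mem_xor h := by
    have key : ∀ h : H, h ∈ σ₀.carrier →
        (∃ f ∈ F, f ≤ PocSet.star h) ∨ ∀ f ∈ F, ¬ h ≤ PocSet.star f := fun h _ => by
      by_cases hc : ∃ f ∈ F, f ≤ PocSet.star h
      · exact Or.inl hc
      · exact Or.inr fun f hf hle => hc ⟨f, hf, le_star_comm hle⟩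
    have hor : ((∃ f ∈ F, f ≤ h) ∨ (h ∈ σ₀.carrier ∧ ∀ f ∈ F, ¬ h ≤ PocSet.star f)) ∨
        ((∃ f ∈ F, f ≤ PocSet.star h) ∨
          (PocSet.star h ∈ σ₀.carrier ∧ ∀ f ∈ F, ¬ PocSet.star h ≤ PocSet.star f)) := by
      by_cases h0 : h ∈ σ₀.carrier
      · rcases key h h0 with h1 | h1
        · exact Or.inr (Or.inl h1)
        · exact Or.inl (Or.inr ⟨h0, h1⟩)
      · have h0' := (σ₀.star_mem_iff h).2 h0
        rcases key _ h0' with h1 | h1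
        · rw [PocSet.star_star] at h1
          exact Or.inl (Or.inl h1)
        · exact Or.inr (Or.inr ⟨h0', h1⟩)
    have hnot : ¬ (((∃ f ∈ F, f ≤ h) ∨ (h ∈ σ₀.carrier ∧ ∀ f ∈ F, ¬ h ≤ PocSet.star f)) ∧
        ((∃ f ∈ F, f ≤ PocSet.star h) ∨
          (PocSet.star h ∈ σ₀.carrier ∧ ∀ f ∈ F, ¬ PocSet.star h ≤ PocSet.star f))) := by
      rintro ⟨⟨f, hf, h1⟩ | ⟨h1, h2⟩, ⟨g, hg, h3⟩ | ⟨h3, h4⟩⟩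
      · exact σ.isFilterBase f (hF hf) g (hF hg) (h1.trans (le_star_comm h3))
      · exact h4 f hf (PocSet.star_le_star _ _ h1)
      · exact h2 g hg (le_star_comm h3)
      · exact (σ₀.star_mem_iff h).1 h3 h1
    rcases hor with h1 | h1
    · exact Or.inl ⟨h1, fun h2 => hnot ⟨h1, h2⟩⟩
    · exact Or.inr ⟨h1, fun h2 => hnot ⟨h2, h1⟩⟩
  isFilterBase := by
    rintro a (⟨f, hf, h1⟩ | ⟨h1, h2⟩) b (⟨g, hg, h3⟩ | ⟨h3, h4⟩) hab
    · exact σ.isFilterBase f (hF hf) g (hF hg)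
        ((h1.trans hab).trans (PocSet.star_le_star _ _ h3))
    · exact h4 f hf (le_star_comm (h1.trans hab))
    · exact h2 g hg (hab.trans (PocSet.star_le_star _ _ h3))
    · exact σ₀.isFilterBase a h1 b h3 hab

/-- If every member of `σ` is separated from `σ₀` by finitely many elements only, then `σ` is a
limit of finite modifications of `σ₀`. -/
theorem toClass_le_toClass {σ₀ σ : PocUltrafilter H}
    (hfin : ∀ f ∈ σ.carrier, {h ∈ σ₀.carrier | h ≤ PocSet.star f}.Finite) :
    σ₀.toClass ≤ σ.toClass := by
  classical
  refine ⟨σ, rfl, mem_closure_of_forall_finset fun F => ?_⟩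
  -- for each element of `F`, the one of it and its complement that lies in `σ`
  let F' : Set H := {f | f ∈ σ.carrier ∧ (f ∈ F ∨ PocSet.star f ∈ F)}
  have hF' : F' ⊆ σ.carrier := fun f hf => hf.1
  have hF'fin : F'.Finite := by
    refine (F.finite_toSet.union (F.finite_toSet.image PocSet.star)).subset ?_
    rintro f ⟨-, hf | hf⟩
    · exact Or.inl hf
    · exact Or.inr ⟨_, hf, PocSet.star_star f⟩
  refine ⟨modify σ₀ σ F' hF', ?_, fun f hf => ?_⟩
  · have hA : (⋃ f ∈ F', {h ∈ σ₀.carrier | h ≤ PocSet.star f}).Finite :=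
      hF'fin.biUnion fun f hf => hfin f hf.1
    refine toClass_eq_iff.2 ((hA.union (hA.image PocSet.star)).subset ?_)
    rintro h (⟨h1 | h1, h2⟩ | ⟨h1, h2⟩)
    · obtain ⟨f, hf, hle⟩ := h1
      refine Or.inr ⟨PocSet.star h, mem_biUnion hf ⟨(σ₀.star_mem_iff h).2 h2, ?_⟩,
        PocSet.star_star h⟩
      exact PocSet.star_le_star _ _ hle
    · exact absurd h1.1 h2
    · refine Or.inl ?_
      have h3 : ¬ ∀ f ∈ F', ¬ h ≤ PocSet.star f := fun h3 => h2 (Or.inr ⟨h1, h3⟩)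
      push Not at h3
      obtain ⟨f, hf, hle⟩ := h3
      exact mem_biUnion hf ⟨h1, hle⟩
  · constructor
    · intro h
      by_contra hn
      refine ((modify σ₀ σ F' hF').star_mem_iff f).1 (Or.inl ⟨_, ⟨?_, ?_⟩, le_rfl⟩) h
      · exact (σ.star_mem_iff f).2 hn
      · exact Or.inr (by rwa [PocSet.star_star])
    · exact fun h => Or.inl ⟨f, ⟨h, Or.inl hf⟩, le_rfl⟩

end PocUltrafilter

end Poc

/-! ### Convexity of the metric -/

section Metric

variable {X : Type*} [MetricSpace X]

theorem IsCAT0.exists_dist_eq (hX : IsCAT0 X) (x y : X) {t : ℝ} (ht : t ∈ Icc (0 : ℝ) 1) :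
    ∃ z, dist x z = t * dist x y ∧ dist z y = (1 - t) * dist x y := by
  obtain ⟨γ, h0, h1, hγ⟩ := hX.exists_geodesic x y
  have hd : 0 ≤ dist x y := dist_nonneg
  have hmem : t * dist x y ∈ Icc 0 (dist x y) :=
    ⟨mul_nonneg ht.1 hd, mul_le_of_le_one_left hd ht.2⟩
  refine ⟨γ (t * dist x y), ?_, ?_⟩
  · have e := hγ 0 (left_mem_Icc.2 hd) _ hmem
    rwa [h0, zero_sub, abs_neg, abs_of_nonneg hmem.1] at e
  · have e := hγ _ hmem _ (right_mem_Icc.2 hd)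
    rw [h1, abs_sub_comm, abs_of_nonneg (sub_nonneg.2 hmem.2)] at e
    rw [e]
    ring

/-- Thales' inequality: two sides of a triangle with common vertex `p`, shrunk towards `p` by the
same factor. -/
theorem IsCAT0.dist_le_of_common_vertex (hX : IsCAT0 X) {p y y' z z' : X} {t : ℝ}
    (ht : t ∈ Icc (0 : ℝ) 1) (h₁ : dist p z = t * dist p y) (h₂ : dist z y = (1 - t) * dist p y)
    (h₁' : dist p z' = t * dist p y') (h₂' : dist z' y' = (1 - t) * dist p y') :
    dist z z' ≤ t * dist y y' := by
  have e₁ := hX.comparison z' p y z t ht h₁ h₂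
  have e₂ := hX.comparison y p y' z' t ht h₁' h₂'
  rw [dist_comm z' p, dist_comm z' y, h₁', dist_comm z' z] at e₁
  rw [dist_comm y p] at e₂
  refine abs_le_of_sq_le_sq' ?_ (mul_nonneg ht.1 dist_nonneg) |>.2
  nlinarith [mul_le_mul_of_nonneg_left e₂ ht.1]

/-- Convexity of the metric along two geodesic segments. -/
theorem IsCAT0.dist_le_of_segments (hX : IsCAT0 X) {x y x' y' z z' : X} {t : ℝ}
    (ht : t ∈ Icc (0 : ℝ) 1) (h₁ : dist x z = t * dist x y) (h₂ : dist z y = (1 - t) * dist x y)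
    (h₁' : dist x' z' = t * dist x' y') (h₂' : dist z' y' = (1 - t) * dist x' y') :
    dist z z' ≤ (1 - t) * dist x x' + t * dist y y' := by
  obtain ⟨w, hw, hw'⟩ := hX.exists_dist_eq x y' ht
  have e₁ := hX.dist_le_of_common_vertex ht h₁ h₂ hw hw'
  have ht' : 1 - t ∈ Icc (0 : ℝ) 1 := ⟨by linarith [ht.2], by linarith [ht.1]⟩
  have e₂ := hX.dist_le_of_common_vertex (p := y') (y := x) (y' := x') (z := w) (z' := z') ht'
    (by rw [dist_comm, hw', dist_comm x]) (by rw [dist_comm, hw, dist_comm x]; ring)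
    (by rw [dist_comm, h₂', dist_comm x']) (by rw [dist_comm, h₁', dist_comm x']; ring)
  linarith [dist_triangle z w z']

theorem GeodConvex.closure (hX : IsCAT0 X) {C : Set X} (hC : GeodConvex C) :
    GeodConvex (closure C) := by
  intro x hx y hy z hz
  rcases eq_or_ne x y with rfl | hxy
  · rw [dist_self, dist_comm z x] at hz
    have : dist x z = 0 := by linarith
    rwa [← dist_eq_zero.1 this]
  have hd : 0 < dist x y := dist_pos.2 hxy
  have ht : dist x z / dist x y ∈ Icc (0 : ℝ) 1 :=
    ⟨by positivity, (div_le_one hd).2 (by linarith [dist_nonneg (x := z) (y := y)])⟩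
  have h₁ : dist x z = dist x z / dist x y * dist x y := by field_simp
  have h₂ : dist z y = (1 - dist x z / dist x y) * dist x y := by
    field_simp
    linarith
  set t := dist x z / dist x y
  refine Metric.mem_closure_iff.2 fun ε hε => ?_
  obtain ⟨x', hx', hxε⟩ := Metric.mem_closure_iff.1 hx ε hε
  obtain ⟨y', hy', hyε⟩ := Metric.mem_closure_iff.1 hy ε hε
  obtain ⟨z', h₁', h₂'⟩ := hX.exists_dist_eq x' y' ht
  refine ⟨z', hC x' hx' y' hy' z' (by rw [h₁', h₂']; ring), ?_⟩
  have := hX.dist_le_of_segments ht h₁ h₂ h₁' h₂'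
  have ha := mul_le_mul_of_nonneg_left hxε.le (sub_nonneg.2 ht.2)
  have hb := mul_le_mul_of_nonneg_left hyε.le ht.1
  rcases lt_or_ge 0 t with h0 | h0
  · have hb' := mul_lt_mul_of_pos_left hyε h0
    linarith
  · have h0' : t = 0 := le_antisymm h0 ht.1
    rw [h0'] at this
    linarith

/-- Geodesic segments: any two points lie in a compact connected set of points between them. -/
theorem IsCAT0.exists_segment (hX : IsCAT0 X) (x y : X) :
    ∃ s : Set X, x ∈ s ∧ y ∈ s ∧ IsCompact s ∧ IsPreconnected s ∧
      ∀ z ∈ s, dist x z + dist z y = dist x y := by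
  obtain ⟨γ, h0, h1, hγ⟩ := hX.exists_geodesic x y
  have hd : 0 ≤ dist x y := dist_nonneg
  have hγc : ContinuousOn γ (Icc 0 (dist x y)) := by
    refine (LipschitzOnWith.of_dist_le_mul (K := 1) fun s hs t ht => ?_).continuousOn
    rw [hγ s hs t ht, Real.dist_eq]
    simp
  refine ⟨γ '' Icc 0 (dist x y), ⟨0, left_mem_Icc.2 hd, h0⟩, ⟨_, right_mem_Icc.2 hd, h1⟩,
    isCompact_Icc.image_of_continuousOn hγc, isPreconnected_Icc.image γ hγc, ?_⟩
  rintro _ ⟨t, ht, rfl⟩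
  have e₁ := hγ 0 (left_mem_Icc.2 hd) t ht
  have e₂ := hγ t ht _ (right_mem_Icc.2 hd)
  rw [h0, abs_of_nonpos (by linarith [ht.1])] at e₁
  rw [h1, abs_of_nonpos (by linarith [ht.2])] at e₂
  rw [e₁, e₂]
  ring

theorem GeodConvex.isPreconnected (hX : IsCAT0 X) {C : Set X} (hC : GeodConvex C) :
    IsPreconnected C := by
  refine isPreconnected_of_forall_pair fun x hx y hy => ?_
  obtain ⟨s, hxs, hys, -, hs, hbetween⟩ := hX.exists_segment x y
  exact ⟨s, fun z hz => hC x hx y hy z (hbetween z hz), hxs, hys, hs⟩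

end Metric

/-! ### Geodesic rays -/

section Rays

variable {X : Type*} [MetricSpace X]

theorem GeodesicRay.dist_eq (c : GeodesicRay X) (s t : ℝ≥0) :
    dist (c.1 s) (c.1 t) = |(s : ℝ) - t| := by
  rw [c.2.dist_eq, NNReal.dist_eq]

theorem GeodesicRay.dist_eq_of_le (c : GeodesicRay X) {s t : ℝ≥0} (h : s ≤ t) :
    dist (c.1 s) (c.1 t) = t - s := by
  rw [c.dist_eq, abs_sub_comm, abs_of_nonneg (sub_nonneg.2 (NNReal.coe_le_coe.2 h))]

theorem GeodesicRay.dist_zero (c : GeodesicRay X) (t : ℝ≥0) : dist (c.1 0) (c.1 t) = t := by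
  simpa using c.dist_eq_of_le (zero_le (a := t))

/-- The part of a ray beyond the parameter `a`. -/
def GeodesicRay.shift (c : GeodesicRay X) (a : ℝ≥0) : GeodesicRay X :=
  ⟨fun t => c.1 (t + a), c.2.comp (Isometry.of_dist_eq fun s t => by simp [NNReal.dist_eq])⟩

theorem GeodesicRay.endpoint_shift (c : GeodesicRay X) (a : ℝ≥0) :
    (c.shift a).endpoint = c.endpoint :=
  Quotient.sound ⟨a, fun t => by
    show dist (c.1 (t + a)) (c.1 t) ≤ a
    rw [dist_comm, c.dist_eq_of_le (self_le_add_right t a)]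
    simp⟩

/-- The image of a ray under an isometry of the acting group. -/
def GeodesicRay.smul {G : Type*} [Group G] [MulAction G X] [IsIsometricSMul G X] (g : G)
    (c : GeodesicRay X) : GeodesicRay X :=
  ⟨fun t => g • c.1 t, (isometry_smul X g).comp c.2⟩

theorem GeodesicRay.endpoint_smul_mem {G : Type*} [Group G] [MulAction G X]
    [IsIsometricSMul G X] (g : G) (c : GeodesicRay X) {C : Set X}
    (h : c.endpoint ∈ boundaryOf C) : (c.smul g).endpoint ∈ boundaryOf (g • C) := by
  obtain ⟨r, hr, hC⟩ := h
  obtain ⟨K, hK⟩ : ∃ K : ℝ, ∀ t, dist (r.1 t) (c.1 t) ≤ K := Quotient.exact hr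
  refine ⟨r.smul g, Quotient.sound ⟨K, fun t => ?_⟩, fun t => smul_mem_smul_set (hC t)⟩
  show dist (g • r.1 t) (g • c.1 t) ≤ K
  rw [dist_smul]
  exact hK t

theorem boundaryOf_mono {C D : Set X} (h : C ⊆ D) : boundaryOf C ⊆ boundaryOf D :=
  fun _ ⟨c, hc, hC⟩ => ⟨c, hc, fun t => h (hC t)⟩

/-- The distance to a convex set does not increase along a ray ending in its boundary. -/
theorem infDist_le_of_endpoint_mem (hX : IsCAT0 X) {C : Set X} (hC : GeodConvex C)
    (s : GeodesicRay X) (h : s.endpoint ∈ boundaryOf C) (t : ℝ≥0) :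
    Metric.infDist (s.1 t) C ≤ Metric.infDist (s.1 0) C := by
  obtain ⟨r, hr, hrC⟩ := h
  obtain ⟨K, hK⟩ : ∃ K : ℝ, ∀ t, dist (r.1 t) (s.1 t) ≤ K := Quotient.exact hr
  refine (Metric.le_infDist ⟨_, hrC 0⟩).2 fun q hq => ?_
  have hK0 : 0 ≤ K := dist_nonneg.trans (hK 0)
  -- compare the segment from `s 0` to `s (t + n + 1)` with the one from `q` to `r (t + n + 1)`
  have key : ∀ n : ℕ, Metric.infDist (s.1 t) C ≤ dist (s.1 0) q + t * K * (1 / ((n : ℝ) + 1)) := by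
    intro n
    let T : ℝ≥0 := t + (n + 1)
    have htT : t ≤ T := self_le_add_right _ _
    have hTn : (n : ℝ) + 1 ≤ T := by
      simp only [T, NNReal.coe_add, NNReal.coe_natCast, NNReal.coe_one]
      linarith [t.2]
    have hn : (0 : ℝ) < (n : ℝ) + 1 := by positivity
    have hT : (0 : ℝ) < T := hn.trans_le hTn
    have hl : (t : ℝ) / T ∈ Icc (0 : ℝ) 1 := ⟨by positivity, (div_le_one hT).2 htT⟩
    obtain ⟨m, hm, hm'⟩ := hX.exists_dist_eq q (r.1 T) hl
    have hmC : m ∈ C := hC q hq _ (hrC T) m (by rw [hm, hm']; ring)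
    have e := hX.dist_le_of_segments (x := s.1 0) (y := s.1 T) (z := s.1 t) hl
      (by rw [s.dist_zero, s.dist_zero]; field_simp)
      (by rw [s.dist_zero, s.dist_eq_of_le htT]; field_simp) hm hm'
    have hKT := hK T
    rw [dist_comm] at hKT
    have e₁ : (1 - (t : ℝ) / T) * dist (s.1 0) q ≤ dist (s.1 0) q :=
      mul_le_of_le_one_left dist_nonneg (by linarith [hl.1])
    have e₂ : (t : ℝ) / T * dist (s.1 T) (r.1 T) ≤ t * K * (1 / ((n : ℝ) + 1)) := by
      calc (t : ℝ) / T * dist (s.1 T) (r.1 T) ≤ t / T * K :=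
            mul_le_mul_of_nonneg_left hKT hl.1
        _ = t * K * (1 / T) := by ring
        _ ≤ _ := by
            refine mul_le_mul_of_nonneg_left ?_ (mul_nonneg t.2 hK0)
            exact one_div_le_one_div_of_le hn hTn
    exact (Metric.infDist_le_dist_of_mem hmC).trans (by linarith)
  have hlim : Tendsto (fun n : ℕ => dist (s.1 0) q + t * K * (1 / ((n : ℝ) + 1))) atTop
      (𝓝 (dist (s.1 0) q + t * K * 0)) :=
    (tendsto_one_div_add_atTop_nhds_zero_nat.const_mul _).const_add _
  simpa using ge_of_tendsto' hlim key

/-- The distance to a convex set `C` is a convex function: on a geodesic through `y` in `C`, then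
`x` outside `closure C`, then `z`, it grows strictly from `x` to `z`. -/
theorem infDist_lt_infDist (hX : IsCAT0 X) {C : Set X} (hC : GeodConvex C) {x y z : X}
    (hy : y ∈ C) (hx : x ∉ closure C) (hxz : x ≠ z) (h : dist y x + dist x z = dist y z) :
    Metric.infDist x C < Metric.infDist z C := by
  have hne : C.Nonempty := ⟨y, hy⟩
  have hpos : 0 < Metric.infDist x C := (Metric.infDist_pos_iff_notMem_closure hne).1 hx
  have hyx : 0 < dist y x := dist_pos.2 fun h => hx (h ▸ subset_closure hy)
  have hxz' : 0 < dist x z := dist_pos.2 hxz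
  have hyz : 0 < dist y z := by linarith
  have hl : dist y x / dist y z ∈ Icc (0 : ℝ) 1 :=
    ⟨by positivity, (div_le_one hyz).2 (by linarith)⟩
  have hl1 : dist y x / dist y z < 1 := (div_lt_one hyz).2 (by linarith)
  have hl0 : 0 < dist y x / dist y z := by positivity
  have h₁ : dist y x = dist y x / dist y z * dist y z := by field_simp
  have h₂ : dist x z = (1 - dist y x / dist y z) * dist y z := by
    field_simp
    linarith
  set l := dist y x / dist y z
  have key : Metric.infDist x C / l ≤ Metric.infDist z C := by
    refine (Metric.le_infDist hne).2 fun q hq => ?_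
    obtain ⟨m, hm, hm'⟩ := hX.exists_dist_eq y q hl
    have hmC : m ∈ C := hC y hy q hq m (by rw [hm, hm']; ring)
    rw [div_le_iff₀' hl0]
    exact (Metric.infDist_le_dist_of_mem hmC).trans
      (hX.dist_le_of_common_vertex hl h₁ h₂ hm hm')
  refine lt_of_lt_of_le ?_ key
  rw [lt_div_iff₀ hl0]
  nlinarith

end Rays

/-! ### Halfspaces and their walls -/

namespace HalfspaceSystem

variable {X : Type*} [MetricSpace X] {𝓗 : HalfspaceSystem X}

theorem notMem_closure_hstar (h : 𝓗.carrier) {x : X} :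
    x ∉ closure (hstar h.1) ↔ x ∈ h.1 := by
  rw [← mem_compl_iff]
  conv_rhs => rw [← 𝓗.star_star h.1 h.2]
  rfl

theorem disjoint_closure_hstar (h : 𝓗.carrier) : Disjoint h.1 (closure (hstar h.1)) :=
  disjoint_left.2 fun _ hx => (notMem_closure_hstar h).2 hx

theorem wall_compl (h : 𝓗.carrier) : (wall h.1)ᶜ = h.1 ∪ hstar h.1 := by
  rw [wall, compl_inter, union_comm]
  congr 1
  exact 𝓗.star_star h.1 h.2

theorem wall_star (h : 𝓗.carrier) : wall (PocSet.star h).1 = wall h.1 := by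
  show closure (hstar h.1) ∩ closure (hstar (hstar h.1)) = _
  rw [𝓗.star_star h.1 h.2, inter_comm]
  rfl

theorem geodConvex_closure (hX : IsCAT0 X) (h : 𝓗.carrier) : GeodConvex (closure h.1) :=
  (𝓗.isHalfspace h.1 h.2).2.1.closure hX

theorem isOpen_star (h : Set X) : IsOpen (hstar h) := isClosed_closure.isOpen_compl

/-- A non-empty wall determines its halfspace up to complementation. -/
theorem eq_or_eq_star_of_wall_eq (hX : IsCAT0 X) {h k : 𝓗.carrier}
    (hne : (wall h.1).Nonempty) (hk : wall k.1 = wall h.1) : k = h ∨ k = PocSet.star h := by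
  -- each of the connected sets `k`, `k*` lies on one side of the common wall
  have hside : ∀ k : 𝓗.carrier, wall k.1 = wall h.1 → k ≤ h ∨ k ≤ PocSet.star h := by
    intro k hk
    refine IsPreconnected.subset_or_subset (𝓗.isHalfspace h.1 h.2).1 (isOpen_star h.1)
      ((disjoint_closure_hstar h).mono_right subset_closure) ?_
      ((𝓗.isHalfspace k.1 k.2).2.1.isPreconnected hX)
    show k.1 ⊆ h.1 ∪ hstar h.1
    rw [← wall_compl h, ← hk, wall_compl k]
    exact subset_union_left
  have hboth : ∀ h : 𝓗.carrier, (wall h.1).Nonempty → wall k.1 = wall h.1 → k ≤ h →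
      PocSet.star k ≤ h → False := by
    intro h hne hk h₁ h₂
    have hsub : (wall h.1)ᶜ ⊆ h.1 := by
      rw [← hk, wall_compl k]
      exact union_subset h₁ h₂
    have hempty : hstar h.1 = ∅ := by
      refine eq_empty_of_subset_empty fun x hx => ?_
      have : x ∈ h.1 := hsub (by rw [wall_compl h]; exact Or.inr hx)
      exact hx (subset_closure this)
    obtain ⟨x, -, hx⟩ := hne
    rw [hempty, closure_empty] at hx
    exact hx
  have hk' : wall (PocSet.star k).1 = wall h.1 := (wall_star k).trans hk
  rcases hside k hk with h₁ | h₁ <;> rcases hside _ hk' with h₂ | h₂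
  · exact (hboth h hne hk h₁ h₂).elim
  · refine Or.inl (le_antisymm h₁ ?_)
    have := le_star_comm h₂
    rwa [PocSet.star_star] at this
  · refine Or.inr (le_antisymm h₁ ?_)
    have := PocSet.star_le_star _ _ h₂
    rwa [PocSet.star_star] at this
  · refine (hboth (PocSet.star h) ?_ ?_ h₁ h₂).elim
    · rwa [wall_star]
    · rwa [wall_star]

theorem finite_walls_of_isCompact {s : Set X} (hs : IsCompact s) :
    {W | (∃ h ∈ 𝓗.carrier, W = wall h) ∧ (W ∩ s).Nonempty}.Finite := by
  choose U hU hfin using 𝓗.locally_finite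
  obtain ⟨t, -, ht⟩ := hs.elim_nhds_subcover U fun x _ => hU x
  refine (t.finite_toSet.biUnion fun x _ => hfin x).subset ?_
  rintro W ⟨hW, x, hxW, hxs⟩
  obtain ⟨y, hy, hxy⟩ := mem_iUnion₂.1 (ht hxs)
  exact mem_biUnion (Finset.mem_coe.2 hy) ⟨hW, x, hxW, hxy⟩

/-- Only finitely many halfspaces separate two given points: their walls meet the segment between
the points, which is compact. -/
theorem finite_separating (hX : IsCAT0 X) (x y : X) :
    {h : 𝓗.carrier | x ∈ closure h.1 ∧ y ∈ closure (hstar h.1)}.Finite := by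
  obtain ⟨s, hxs, hys, hc, hs, -⟩ := hX.exists_segment x y
  have hmeet : ∀ h : 𝓗.carrier, x ∈ closure h.1 ∧ y ∈ closure (hstar h.1) →
      (wall h.1 ∩ s).Nonempty := by
    rintro h ⟨h₁, h₂⟩
    have hcov : s ⊆ closure h.1 ∪ closure (hstar h.1) := fun z _ => by
      by_cases hz : z ∈ closure h.1
      · exact Or.inl hz
      · exact Or.inr (subset_closure hz)
    have := isPreconnected_closed_iff.1 hs _ _ isClosed_closure isClosed_closure hcov
      ⟨x, hxs, h₁⟩ ⟨y, hys, h₂⟩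
    rwa [inter_comm] at this
  refine Set.Finite.of_finite_fibers (fun h : 𝓗.carrier => wall h.1) ?_ ?_
  · refine (finite_walls_of_isCompact (𝓗 := 𝓗) hc).subset ?_
    rintro _ ⟨h, hh, rfl⟩
    exact ⟨⟨h.1, h.2, rfl⟩, hmeet h hh⟩
  · rintro _ ⟨h, hh, rfl⟩
    refine (toFinite {h, PocSet.star h}).subset ?_
    rintro k ⟨-, hk⟩
    exact eq_or_eq_star_of_wall_eq hX ((hmeet h hh).mono inter_subset_left) hk

theorem dense_compl_wall (h : 𝓗.carrier) : Dense (wall h.1)ᶜ := by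
  rw [wall_compl, dense_iff_closure_eq, closure_union, eq_univ_iff_forall]
  intro x
  by_cases hx : x ∈ closure h.1
  · exact Or.inl hx
  · exact Or.inr (subset_closure hx)

/-- Walls are closed and nowhere dense, and locally finite in number, so they do not cover a
non-empty space. -/
theorem exists_off_walls (𝓗 : HalfspaceSystem X) (x₀ : X) :
    ∃ x : X, ∀ h : 𝓗.carrier, x ∈ h.1 ∨ x ∈ hstar h.1 := by
  obtain ⟨U, hU, hfin⟩ := 𝓗.locally_finite x₀
  have hd : Dense (⋂₀ (compl '' {W | (∃ h ∈ 𝓗.carrier, W = wall h) ∧ (W ∩ U).Nonempty})) := by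
    refine (hfin.image compl).dense_sInter ?_ ?_
    · rintro _ ⟨W, ⟨⟨h, -, rfl⟩, -⟩, rfl⟩
      exact (isClosed_closure.inter isClosed_closure).isOpen_compl
    · rintro _ ⟨W, ⟨⟨h, hh, rfl⟩, -⟩, rfl⟩
      exact dense_compl_wall (𝓗 := 𝓗) ⟨h, hh⟩
  obtain ⟨x, hx, hxU⟩ := hd.inter_nhds_nonempty hU
  refine ⟨x, fun h => ?_⟩
  have : x ∈ (wall h.1)ᶜ := fun hxW =>
    hx _ ⟨wall h.1, ⟨⟨h.1, h.2, rfl⟩, x, hxW, hxU⟩, rfl⟩ hxW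
  rwa [wall_compl] at this

/-- By convexity, a ray stays eventually on one side of a wall. -/
theorem mem_boundaryOf_or (hX : IsCAT0 X) (h : 𝓗.carrier) (ξ : VisualBoundary X) :
    ξ ∈ boundaryOf (closure h.1) ∨ ξ ∈ boundaryOf (closure (hstar h.1)) := by
  obtain ⟨c, rfl⟩ := Quotient.exists_rep ξ
  by_cases hc : ∀ T, ∃ t ≥ T, c.1 t ∈ closure h.1
  · obtain ⟨t₀, -, h₀⟩ := hc 0
    refine Or.inl ⟨c.shift t₀, c.endpoint_shift t₀, fun t => ?_⟩
    obtain ⟨t₁, ht, h₁⟩ := hc (t + t₀)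
    have hle : t₀ ≤ t + t₀ := le_add_self
    refine geodConvex_closure hX h _ h₀ _ h₁ (c.1 (t + t₀)) ?_
    rw [c.dist_eq_of_le hle, c.dist_eq_of_le ht, c.dist_eq_of_le (hle.trans ht)]
    ring
  · push Not at hc
    obtain ⟨T, hT⟩ := hc
    exact Or.inr ⟨c.shift T, c.endpoint_shift T,
      fun t => subset_closure (hT (t + T) le_add_self)⟩

/-! ### The least class at a boundary point -/

/-- The ultrafilter at `ξ` based at a point `x` off the walls: the halfspaces forced by `ξ` (those
whose complement does not have `ξ` in its boundary), and among the halfspaces with `ξ` in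
the boundary of both sides those that contain `x`. -/
def baseUltrafilter (hX : IsCAT0 X) (ξ : VisualBoundary X) (x : X)
    (hx : ∀ h : 𝓗.carrier, x ∈ h.1 ∨ x ∈ hstar h.1) : PocUltrafilter 𝓗.carrier where
  carrier := {h | ξ ∈ boundaryOf (closure h.1) ∧
    (ξ ∈ boundaryOf (closure (hstar h.1)) → x ∈ h.1)}
  mem_xor h := by
    have e : closure (hstar (hstar h.1)) = closure h.1 := by rw [𝓗.star_star h.1 h.2]
    have h₁ := mem_boundaryOf_or hX h ξ
    have h₂ := hx h
    have h₃ : x ∈ h.1 → x ∉ hstar h.1 := fun h h' => h' (subset_closure h)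
    show Xor (_ ∧ _) (ξ ∈ boundaryOf (closure (hstar h.1)) ∧
      (ξ ∈ boundaryOf (closure (hstar (hstar h.1))) → x ∈ hstar h.1))
    rw [e]
    unfold Xor
    tauto
  isFilterBase := by
    rintro h ⟨h₁, h₂⟩ k ⟨h₃, h₄⟩ hle
    have hk := h₄ (boundaryOf_mono (closure_mono hle) h₁)
    have hh := h₂ (boundaryOf_mono (closure_mono (le_star_comm hle)) h₃)
    exact hle hh (subset_closure hk)

/-- Every ultrafilter at `ξ` contains the halfspaces forced by `ξ`. -/
theorem mem_of_mem_ultrafiltersAt {ξ : VisualBoundary X} {σ : PocUltrafilter 𝓗.carrier}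
    (hσ : σ ∈ 𝓗.ultrafiltersAt ξ) {h : 𝓗.carrier}
    (hh : ξ ∉ boundaryOf (closure (hstar h.1))) : h ∈ σ.carrier := by
  by_contra hn
  exact hh (hσ _ ((σ.star_mem_iff h).2 hn))

theorem isLeast_baseUltrafilter (hX : IsCAT0 X) (ξ : VisualBoundary X) (x : X)
    (hx : ∀ h : 𝓗.carrier, x ∈ h.1 ∨ x ∈ hstar h.1) :
    IsLeast (𝓗.classesAt ξ) (baseUltrafilter hX ξ x hx).toClass := by
  refine ⟨⟨baseUltrafilter hX ξ x hx, fun h hh => hh.1, rfl⟩, ?_⟩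
  rintro _ ⟨σ, hσ, rfl⟩
  refine PocUltrafilter.toClass_le_toClass fun f hf => ?_
  obtain ⟨y, hy⟩ : f.1.Nonempty := by
    rw [nonempty_iff_ne_empty]
    intro h0
    refine σ.isFilterBase f hf f hf fun z hz => ?_
    rw [h0] at hz
    exact hz.elim
  refine (finite_separating (𝓗 := 𝓗) hX x y).subset ?_
  rintro h ⟨⟨-, h₂⟩, hle⟩
  by_cases hξ : ξ ∈ boundaryOf (closure (hstar h.1))
  · exact ⟨subset_closure (h₂ hξ), subset_closure (le_star_comm hle hy)⟩
  · exact (σ.isFilterBase h (mem_of_mem_ultrafiltersAt hσ hξ) f hf hle).elim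

theorem isLeast_rho (hX : IsCAT0 X) (𝓗 : HalfspaceSystem X) (ξ : VisualBoundary X) :
    IsLeast (𝓗.classesAt ξ) (𝓗.rho ξ) := by
  obtain ⟨c, -⟩ := Quotient.exists_rep ξ
  obtain ⟨x, hx⟩ := exists_off_walls 𝓗 (c.1 0)
  exact Classical.epsilon_spec_aux (𝓗.nonempty_roller ξ) _
    ⟨_, isLeast_baseUltrafilter hX ξ x hx⟩

/-- If `ρ(ξ)` is not the principal class, then halfspaces forced by `ξ` descend to infinity, away
from any given point `y`. -/
theorem exists_chain (hX : IsCAT0 X) {ξ : VisualBoundary X}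
    (hξ : ¬ (𝓗.rho ξ).IsPrincipalClass) (y : X) :
    ∃ k : ℕ → 𝓗.carrier, StrictAnti k ∧
      ∀ n, ξ ∉ boundaryOf (closure (hstar (k n).1)) ∧ y ∈ hstar (k n).1 := by
  obtain ⟨x, hx⟩ := exists_off_walls 𝓗 y
  obtain ⟨⟨σ, hσ, hσρ⟩, hle⟩ := isLeast_rho hX 𝓗 ξ
  obtain ⟨k, hk, hkσ⟩ := PocUltrafilter.exists_strictAnti_of_not_isPrincipal
    fun h => hξ ⟨σ, hσρ, h⟩
  -- the chain persists from `ρ(ξ)` to the class of the base ultrafilter, which is above it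
  have hkx : ∀ n, k n ∈ (baseUltrafilter hX ξ x hx).carrier := by
    obtain ⟨τ, hτ, hτσ⟩ := hle (isLeast_baseUltrafilter hX ξ x hx).1
    rw [← hσρ] at hτσ
    exact PocUltrafilter.mem_of_strictAnti_of_toClass_eq hτ hk
      (PocUltrafilter.mem_of_strictAnti_of_mem_closure hk hkσ hτσ)
  have hshift : ∀ N, (range fun n => k (N + n)).Infinite := fun N =>
    infinite_range_of_injective (hk.injective.comp (add_right_injective N))
  -- a chain around `x` would consist of halfspaces separating `x` from a point of `(k 1)*`
  obtain ⟨N, hN⟩ : ∃ N, x ∉ (k N).1 := by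
    by_contra! hall
    obtain ⟨z, hz⟩ : (hstar (k 1).1).Nonempty := by
      rw [nonempty_iff_ne_empty]
      intro h0
      have h1 : (k 1).1 = univ := by
        rw [← 𝓗.star_star _ (k 1).2, h0, hstar, closure_empty, compl_empty]
      exact (hk zero_lt_one).not_ge (show (k 0).1 ⊆ (k 1).1 from h1 ▸ subset_univ _)
    refine hshift 1 ((finite_separating (𝓗 := 𝓗) hX x z).subset ?_)
    rintro _ ⟨n, rfl⟩
    exact ⟨subset_closure (hall _), subset_closure
      (PocSet.star_le_star _ _ (hk.antitone (Nat.le_add_right 1 n)) hz)⟩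
  have hxs : ∀ n, x ∈ hstar (k (N + n)).1 := fun n =>
    (hx _).resolve_left fun h => hN (hk.antitone (Nat.le_add_right N n) h)
  obtain ⟨M, hM⟩ : ∃ M, y ∉ closure (k (N + M)).1 := by
    by_contra! hall
    refine hshift N ((finite_separating (𝓗 := 𝓗) hX y x).subset ?_)
    rintro _ ⟨n, rfl⟩
    exact ⟨hall n, subset_closure (hxs n)⟩
  refine ⟨fun n => k (N + M + n), hk.comp_strictMono (add_right_strictMono), fun n => ⟨?_, ?_⟩⟩
  · intro hn
    have := (hkx (N + M + n)).2 hn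
    rw [add_assoc] at this
    exact hxs (M + n) (subset_closure this)
  · exact PocSet.star_le_star _ _ (hk.antitone (Nat.le_add_right (N + M) n)) hM

/-! ### Opposite rays -/

/-- If `ξ` forces all members of a descending chain and `η` forces all their complements, then
`ρ(ξ)` is not below `ρ(η)`. -/
theorem not_rho_le_rho (hX : IsCAT0 X) {ξ η : VisualBoundary X} {k : ℕ → 𝓗.carrier}
    (hk : StrictAnti k) (hξ : ∀ n, ξ ∉ boundaryOf (closure (hstar (k n).1)))
    (hη : ∀ n, η ∉ boundaryOf (closure (k n).1)) : ¬ 𝓗.rho ξ ≤ 𝓗.rho η := by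
  obtain ⟨σ, hσ, hσρ⟩ := (isLeast_rho hX 𝓗 ξ).1
  obtain ⟨τ, hτ, hτρ⟩ := (isLeast_rho hX 𝓗 η).1
  rw [← hσρ, ← hτρ]
  rintro ⟨υ, hυ, hυσ⟩
  have := PocUltrafilter.mem_of_strictAnti_of_toClass_eq hυ hk
    (PocUltrafilter.mem_of_strictAnti_of_mem_closure hk
      (fun n => mem_of_mem_ultrafiltersAt hσ (hξ n)) hυσ) 0
  exact hη 0 (hτ _ this)

/-- If a ray starts outside `closure h` and meets `h`, then its end forces `h`. -/
theorem notMem_boundaryOf_hstar (hX : IsCAT0 X) (h : 𝓗.carrier) (r : GeodesicRay X)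
    (h₀ : r.1 0 ∈ hstar h.1) {T : ℝ≥0} (hT : r.1 T ∈ h.1) :
    r.endpoint ∉ boundaryOf (closure (hstar h.1)) := fun hr => by
  have hne : (closure (hstar h.1)).Nonempty := ⟨_, subset_closure h₀⟩
  have hle := infDist_le_of_endpoint_mem hX (geodConvex_closure hX (PocSet.star h)) r hr T
  have h0 : Metric.infDist (r.1 0) (closure (hstar h.1)) = 0 :=
    (isClosed_closure.mem_iff_infDist_zero hne).1 (subset_closure h₀)
  refine (notMem_closure_hstar h).2 hT ((isClosed_closure.mem_iff_infDist_zero hne).2 ?_)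
  exact le_antisymm (hle.trans h0.le) Metric.infDist_nonneg

/-- A ray whose end is not in the boundary of `h*` meets `h`. -/
theorem exists_mem_of_notMem_boundaryOf (h : 𝓗.carrier) (r : GeodesicRay X)
    (hr : r.endpoint ∉ boundaryOf (closure (hstar h.1))) : ∃ T, r.1 T ∈ h.1 := by
  by_contra! hall
  exact hr ⟨r, rfl, fun t => by_contra fun ht => hall t ((notMem_closure_hstar h).1 ht)⟩

/-- Let the rays `r` and `s` form a geodesic line. If `r` meets `h` and the common origin is
outside `closure h`, then the distance to `h` grows along `s`. -/
theorem infDist_lt_of_opposite (hX : IsCAT0 X) (h : 𝓗.carrier) {r s : GeodesicRay X}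
    (hrs : ∀ T t, dist (r.1 T) (s.1 t) = T + t) (h₀ : r.1 0 ∈ hstar h.1) {T : ℝ≥0}
    (hT : r.1 T ∈ h.1) :
    Metric.infDist (s.1 0) (closure h.1) < Metric.infDist (s.1 1) (closure h.1) := by
  have h0 : r.1 0 = s.1 0 := dist_eq_zero.1 (by simp [hrs])
  refine infDist_lt_infDist hX (geodConvex_closure hX h) (subset_closure hT) ?_ ?_ ?_
  · rw [closure_closure, ← h0]
    exact h₀
  · intro he
    have := s.dist_zero 1
    rw [← he, dist_self] at this
    simp at this
  · rw [hrs, hrs, s.dist_zero]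
    simp

theorem not_rho_le_rho_of_opposite (hX : IsCAT0 X) {r s : GeodesicRay X}
    (hr : ¬ (𝓗.rho r.endpoint).IsPrincipalClass)
    (hrs : ∀ T t, dist (r.1 T) (s.1 t) = T + t) : ¬ 𝓗.rho r.endpoint ≤ 𝓗.rho s.endpoint := by
  obtain ⟨k, hk, hkr⟩ := exists_chain hX hr (r.1 0)
  refine not_rho_le_rho hX hk (fun n => (hkr n).1) fun n hs => ?_
  obtain ⟨T, hT⟩ := exists_mem_of_notMem_boundaryOf (k n) r (hkr n).1
  exact (infDist_lt_of_opposite hX (k n) hrs (hkr n).2 hT).not_ge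
    (infDist_le_of_endpoint_mem hX (geodConvex_closure hX (k n)) s hs 1)

end HalfspaceSystem

/-! ### Angles and limits of rays -/

section Angle

variable {X : Type*} [MetricSpace X]

theorem GeodesicRay.dist_le_add {r s : GeodesicRay X} (h₀ : r.1 0 = s.1 0) (T t : ℝ≥0) :
    dist (r.1 T) (s.1 t) ≤ T + t := by
  have e₁ : dist (r.1 T) (r.1 0) = T := by rw [dist_comm, r.dist_zero]
  have e₂ : dist (r.1 0) (s.1 t) = t := by rw [h₀, s.dist_zero]
  exact (dist_triangle _ (r.1 0) _).trans (by rw [e₁, e₂])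

/-- The Alexandrov angle is at most the comparison angle, in the form of a lower bound for the
distance of the rays. -/
theorem le_dist_sq_of_le_alexandrovAngle (hX : IsCAT0 X) {c c' : GeodesicRay X}
    (h₀ : c.1 0 = c'.1 0) {θ : ℝ} (hθ : θ ∈ Icc 0 Real.pi) (h : θ ≤ alexandrovAngle c c')
    (t : ℝ≥0) : 2 * (t : ℝ) ^ 2 * (1 - Real.cos θ) ≤ dist (c.1 t) (c'.1 t) ^ 2 := by
  rcases eq_or_lt_of_le (zero_le (a := t)) with rfl | ht
  · simp
  have ht' : (0 : ℝ) < t := ht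
  set D := dist (c.1 t) (c'.1 t) with hD
  -- comparison angles decrease towards the vertex
  have hmono : ∀ q : ℝ≥0 × ℝ≥0, q.1 ∈ Ioc 0 t → q.2 ∈ Ioc 0 t →
      comparisonAngle (c.1 0) (c.1 q.1) (c'.1 q.2) ≤
        Real.arccos ((2 * (t : ℝ) ^ 2 - D ^ 2) / (2 * t ^ 2)) := by
    rintro ⟨a, b⟩ ⟨ha, hat⟩ ⟨hb, hbt⟩
    have ha' : (0 : ℝ) < a := ha
    have hb' : (0 : ℝ) < b := hb
    have hat' : (a : ℝ) ≤ t := hat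
    have hbt' : (b : ℝ) ≤ t := hbt
    refine Real.arccos_le_arccos ?_
    have e₁ := hX.comparison (c'.1 t) (c.1 0) (c.1 t) (c.1 a) (a / t)
      ⟨by positivity, (div_le_one ht').2 hat'⟩
      (by rw [c.dist_zero, c.dist_zero]; field_simp)
      (by rw [c.dist_zero, c.dist_eq_of_le hat]; field_simp)
    have e₂ := hX.comparison (c.1 a) (c'.1 0) (c'.1 t) (c'.1 b) (b / t)
      ⟨by positivity, (div_le_one ht').2 hbt'⟩
      (by rw [c'.dist_zero, c'.dist_zero]; field_simp)
      (by rw [c'.dist_zero, c'.dist_eq_of_le hbt]; field_simp)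
    rw [dist_comm _ (c.1 0), h₀, c'.dist_zero, ← h₀, c.dist_zero, dist_comm _ (c.1 t), ← hD,
      dist_comm _ (c.1 a)] at e₁
    rw [← h₀, dist_comm _ (c.1 0), c.dist_zero, h₀, c'.dist_zero] at e₂
    show _ ≤ (dist (c.1 0) (c.1 a) ^ 2 + dist (c.1 0) (c'.1 b) ^ 2 - dist (c.1 a) (c'.1 b) ^ 2) /
      (2 * dist (c.1 0) (c.1 a) * dist (c.1 0) (c'.1 b))
    have hcb : dist (c.1 0) (c'.1 b) = b := by rw [h₀, c'.dist_zero]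
    rw [hcb, c.dist_zero]
    have e₃ := mul_le_mul_of_nonneg_left e₁ (show (0 : ℝ) ≤ b / t by positivity)
    have e₄ : dist (c.1 a) (c'.1 b) ^ 2 ≤ a ^ 2 + b ^ 2 - a * b / t ^ 2 * (2 * t ^ 2 - D ^ 2) := by
      refine (e₂.trans (add_le_add_left (add_le_add_right e₃ _) _)).trans (le_of_eq ?_)
      field_simp
      ring
    rw [div_le_div_iff₀ (by positivity) (by positivity)]
    have e₅ := mul_le_mul_of_nonneg_left e₄ (show (0 : ℝ) ≤ 2 * t ^ 2 by positivity)
    have e₆ : 2 * (t : ℝ) ^ 2 * (a * b / t ^ 2 * (2 * t ^ 2 - D ^ 2)) =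
        (2 * t ^ 2 - D ^ 2) * (2 * a * b) := by
      field_simp
    nlinarith
  have hle : alexandrovAngle c c' ≤ Real.arccos ((2 * (t : ℝ) ^ 2 - D ^ 2) / (2 * t ^ 2)) := by
    refine limsup_le_of_le ?_ ?_
    · refine IsBoundedUnder.isCoboundedUnder_le ⟨0, eventually_map.2 (.of_forall fun q => ?_)⟩
      exact Real.arccos_nonneg _
    · have hI : Ioc (0 : ℝ≥0) t ∈ 𝓝[>] (0 : ℝ≥0) := Ioc_mem_nhdsGT ht
      filter_upwards [prod_mem_prod hI hI] with q hq
      exact hmono q hq.1 hq.2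
  have hD2 : D ≤ 2 * t := by
    have := GeodesicRay.dist_le_add h₀ t t
    linarith
  have hD0 : 0 ≤ D := dist_nonneg
  have hcos := Real.cos_le_cos_of_nonneg_of_le_pi hθ.1 (Real.arccos_le_pi _) (h.trans hle)
  rw [Real.cos_arccos] at hcos
  · rw [div_le_iff₀ (by positivity)] at hcos
    linarith
  · rw [le_div_iff₀ (by positivity)]
    nlinarith
  · rw [div_le_one (by positivity)]
    nlinarith

/-- In a proper space, rays with origins in a compact set subconverge; along an ultrafilter they
converge. -/
theorem exists_limit_ray [ProperSpace X] (u : Ultrafilter ℕ) {K : Set X} (hK : IsCompact K)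
    (R : ℕ → GeodesicRay X) (hR : ∀ n, (R n).1 0 ∈ K) :
    ∃ r : GeodesicRay X, ∀ t, Tendsto (fun n => (R n).1 t) u (𝓝 (r.1 t)) := by
  have hlim : ∀ t, ∃ x, Tendsto (fun n => (R n).1 t) u (𝓝 x) := fun t => by
    have hc : IsCompact (Metric.cthickening t K) := hK.cthickening
    have hle : (u.map fun n => (R n).1 t : Ultrafilter X) ≤ 𝓟 (Metric.cthickening (t : ℝ) K) := by
      rw [Ultrafilter.coe_map, le_principal_iff, mem_map]
      refine univ_mem' fun n => Metric.mem_cthickening_of_dist_le _ _ _ _ (hR n) ?_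
      rw [dist_comm, (R n).dist_zero]
    obtain ⟨x, -, hx⟩ := hc.ultrafilter_le_nhds _ hle
    exact ⟨x, hx⟩
  choose r hr using hlim
  refine ⟨⟨r, Isometry.of_dist_eq fun s t => ?_⟩, hr⟩
  refine tendsto_nhds_unique ((hr s).dist (hr t)) ?_
  simp only [(R _).2.dist_eq]
  exact tendsto_const_nhds

/-- Two rays from a point whose points at time `t` have distance `2t` form a geodesic line. -/
theorem dist_eq_add_of_dist_eq_two_mul {r s : GeodesicRay X}
    (h : ∀ t : ℝ≥0, dist (r.1 t) (s.1 t) = 2 * t) (T t : ℝ≥0) :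
    dist (r.1 T) (s.1 t) = T + t := by
  have h0 : r.1 0 = s.1 0 := dist_eq_zero.1 (by simp [h])
  refine le_antisymm (GeodesicRay.dist_le_add h0 T t) ?_
  have e := dist_triangle4 (r.1 (max T t)) (r.1 T) (s.1 t) (s.1 (max T t))
  rw [h, dist_comm (r.1 (max T t)), r.dist_eq_of_le (le_max_left T t),
    s.dist_eq_of_le (le_max_right T t)] at e
  linarith

/-- Boundary points at angular distance at least `π` become opposite in a limit of translates:
for a cocompact isometric action, translates of rays to `ξ` and `η` with a common origin converge
to the two halves of a geodesic line. -/
theorem exists_opposite_limit [ProperSpace X] (hX : IsCAT0 X) {G : Type*} [Group G]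
    [MulAction G X] [IsIsometricSMul G X]
    (hcocompact : ∃ K : Set X, IsCompact K ∧ ⋃ g : G, g • K = univ) {ξ η : VisualBoundary X}
    (h : Real.pi ≤ angularDist ξ η) (u : Ultrafilter ℕ) (hu : (u : Filter ℕ) ≤ atTop) :
    ∃ (g : ℕ → G) (C S : ℕ → GeodesicRay X) (r s : GeodesicRay X),
      (∀ n, (C n).endpoint = ξ ∧ (S n).endpoint = η) ∧
      (∀ t, Tendsto (fun n => g n • (C n).1 t) u (𝓝 (r.1 t))) ∧
      (∀ t, Tendsto (fun n => g n • (S n).1 t) u (𝓝 (s.1 t))) ∧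
      ∀ T t, dist (r.1 T) (s.1 t) = T + t := by
  obtain ⟨K, hK, hcov⟩ := hcocompact
  let A := {θ | ∃ c c' : GeodesicRay X, c.endpoint = ξ ∧ c'.endpoint = η ∧ c.1 0 = c'.1 0 ∧
    θ = alexandrovAngle c c'}
  have hne : A.Nonempty := by
    by_contra hemp
    rw [not_nonempty_iff_eq_empty] at hemp
    -- the supremum of the empty set is the junk value `0`
    have h0 : angularDist ξ η = 0 := (congrArg sSup hemp).trans Real.sSup_empty
    linarith [Real.pi_pos]
  have hex : ∀ n : ℕ, ∃ c c' : GeodesicRay X, c.endpoint = ξ ∧ c'.endpoint = η ∧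
      c.1 0 = c'.1 0 ∧ Real.pi - 1 / ((n : ℝ) + 1) ≤ alexandrovAngle c c' := fun n => by
    have hpos : (0 : ℝ) < 1 / ((n : ℝ) + 1) := by positivity
    obtain ⟨_, ⟨c, c', h₁, h₂, h₃, rfl⟩, hlt⟩ := exists_lt_of_lt_csSup hne
      (show Real.pi - 1 / ((n : ℝ) + 1) < sSup A from (sub_lt_self _ hpos).trans_le h)
    exact ⟨c, c', h₁, h₂, h₃, hlt.le⟩
  choose C S hC hS h0 hang using hex
  have hg : ∀ x : X, ∃ g : G, g • x ∈ K := fun x => by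
    obtain ⟨g, hg⟩ := mem_iUnion.1 (hcov ▸ mem_univ x : x ∈ ⋃ g : G, g • K)
    exact ⟨g⁻¹, mem_smul_set_iff_inv_smul_mem.1 hg⟩
  choose g hg using fun n => hg ((C n).1 0)
  obtain ⟨r, hr⟩ := exists_limit_ray u hK (fun n => (C n).smul (g n)) hg
  obtain ⟨s, hs⟩ := exists_limit_ray u hK (fun n => (S n).smul (g n)) fun n => by
    show g n • (S n).1 0 ∈ K
    rw [← h0]
    exact hg n
  refine ⟨g, C, S, r, s, fun n => ⟨hC n, hS n⟩, hr, hs, dist_eq_add_of_dist_eq_two_mul fun t => ?_⟩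
  have hrs0 : r.1 0 = s.1 0 := by
    refine tendsto_nhds_unique (hr 0) ((hs 0).congr fun n => ?_)
    show g n • (S n).1 0 = g n • (C n).1 0
    rw [h0]
  refine le_antisymm ?_ ?_
  · have := GeodesicRay.dist_le_add hrs0 t t
    linarith
  · have hbound : ∀ n : ℕ, 2 * (t : ℝ) ^ 2 * (1 - Real.cos (Real.pi - 1 / ((n : ℝ) + 1))) ≤
        dist (((C n).smul (g n)).1 t) (((S n).smul (g n)).1 t) ^ 2 := fun n => by
      have h1 : 1 / ((n : ℝ) + 1) ≤ 1 := by
        rw [div_le_one (by positivity)]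
        linarith [(n.cast_nonneg : (0 : ℝ) ≤ n)]
      have h2 : (0 : ℝ) ≤ 1 / ((n : ℝ) + 1) := by positivity
      show _ ≤ dist (g n • (C n).1 t) (g n • (S n).1 t) ^ 2
      rw [dist_smul]
      exact le_dist_sq_of_le_alexandrovAngle hX (h0 n)
        ⟨by linarith [Real.two_le_pi], by linarith⟩ (hang n) t
    have hl : Tendsto (fun n : ℕ => 2 * (t : ℝ) ^ 2 *
        (1 - Real.cos (Real.pi - 1 / ((n : ℝ) + 1)))) u
        (𝓝 (2 * (t : ℝ) ^ 2 * (1 - Real.cos (Real.pi - 0)))) := by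
      refine Tendsto.mono_left ?_ hu
      exact ((((Real.continuous_cos.tendsto _).comp
        (tendsto_one_div_add_atTop_nhds_zero_nat.const_sub _)).const_sub _).const_mul _)
    have hfin := le_of_tendsto_of_tendsto' hl (((hr t).dist (hs t)).pow 2) hbound
    rw [sub_zero, Real.cos_pi] at hfin
    exact abs_le_of_sq_le_sq' (by linarith) dist_nonneg |>.2

end Angle

namespace HalfspaceSystem

variable {X : Type*} [MetricSpace X] {𝓗 : HalfspaceSystem X}

theorem hstar_smul {G : Type*} [Group G] [MulAction G X] [IsIsometricSMul G X] (g : G)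
    (h : Set X) : hstar (g • h) = g • hstar h := by
  rw [hstar, hstar, closure_smul, smul_set_compl]

/-- Halfspaces forced by `ξ` with complement forced by `η` lie in the ultrafilters of `ρ(ξ)` at `ξ`
but not in those of `ρ(η)` at `η`. -/
theorem finite_of_rho_eq (hX : IsCAT0 X) {ξ η : VisualBoundary X} (h : 𝓗.rho ξ = 𝓗.rho η) :
    {h : 𝓗.carrier | ξ ∉ boundaryOf (closure (hstar h.1)) ∧
      η ∉ boundaryOf (closure h.1)}.Finite := by
  obtain ⟨σ, hσ, hσρ⟩ := (isLeast_rho hX 𝓗 ξ).1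
  obtain ⟨τ, hτ, hτρ⟩ := (isLeast_rho hX 𝓗 η).1
  rw [← hσρ, ← hτρ] at h
  refine (PocUltrafilter.toClass_eq_iff.1 h).subset ?_
  rintro k ⟨hk, hk'⟩
  exact Or.inl ⟨mem_of_mem_ultrafiltersAt hσ hk, fun hm => hk' (hτ k hm)⟩

/-- Boundary points at angular distance at least `π` have different values of `ρ`: halfspaces that
strongly separate the ends of a limiting line also strongly separate the translates of `ξ` and
`η`, any finite number of them at a time. -/
theorem rho_ne_rho [ProperSpace X] (hX : IsCAT0 X) {G : Type*} [Group G] [MulAction G X]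
    [IsIsometricSMul G X] (hcocompact : ∃ K : Set X, IsCompact K ∧ ⋃ g : G, g • K = univ)
    (hinv : ∀ g : G, ∀ h ∈ 𝓗.carrier, g • h ∈ 𝓗.carrier)
    (hrho : ∀ ξ, ¬ (𝓗.rho ξ).IsPrincipalClass) {ξ η : VisualBoundary X}
    (h : Real.pi ≤ angularDist ξ η) : 𝓗.rho ξ ≠ 𝓗.rho η := fun heq => by
  obtain ⟨g, C, S, r, s, hends, hr, hs, hrs⟩ :=
    exists_opposite_limit hX hcocompact h (hyperfilter ℕ) (Nat.hyperfilter_le_atTop)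
  obtain ⟨k, hk, hkr⟩ := exists_chain hX (hrho r.endpoint) (r.1 0)
  have hfin := finite_of_rho_eq hX heq
  -- each member of the chain strongly separates almost all translates of `ξ` and `η`
  have hsep : ∀ m, ∀ᶠ n in hyperfilter ℕ,
      ((C n).smul (g n)).endpoint ∉ boundaryOf (closure (hstar (k m).1)) ∧
      ((S n).smul (g n)).endpoint ∉ boundaryOf (closure (k m).1) := by
    intro m
    obtain ⟨T, hT⟩ := exists_mem_of_notMem_boundaryOf (k m) r (hkr m).1
    have hlt := infDist_lt_of_opposite hX (k m) hrs (hkr m).2 hT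
    have hcont := Metric.continuous_infDist_pt (closure (k m).1)
    filter_upwards [(hr 0).eventually ((isOpen_star _).mem_nhds (hkr m).2),
      (hr T).eventually ((𝓗.isHalfspace _ (k m).2).1.mem_nhds hT),
      ((hcont.tendsto _).comp (hs 0)).eventually_lt ((hcont.tendsto _).comp (hs 1)) hlt]
      with n h₁ h₂ h₃
    refine ⟨notMem_boundaryOf_hstar hX (k m) ((C n).smul (g n)) h₁ h₂, fun hS => ?_⟩
    exact h₃.not_ge (infDist_le_of_endpoint_mem hX (geodConvex_closure hX (k m)) _ hS 1)
  obtain ⟨n, hn⟩ := ((eventually_all_finset (Finset.range (hfin.toFinset.card + 1))).2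
    fun m _ => hsep m).exists
  -- pull the first members of the chain back by `g n`
  let f : ℕ → 𝓗.carrier := fun m => ⟨(g n)⁻¹ • (k m).1, hinv _ _ (k m).2⟩
  have hf : f.Injective := fun a b hab =>
    hk.injective (Subtype.ext (smul_left_cancel _ (congrArg Subtype.val hab)))
  have hmaps : ∀ m ∈ Finset.range (hfin.toFinset.card + 1), f m ∈ hfin.toFinset := by
    intro m hm
    obtain ⟨h₁, h₂⟩ := hn m hm
    refine hfin.mem_toFinset.2 ⟨fun hmem => h₁ ?_, fun hmem => h₂ ?_⟩
    · have := (C n).endpoint_smul_mem (g n) ((hends n).1 ▸ hmem)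
      rwa [hstar_smul, closure_smul, smul_inv_smul] at this
    · have := (S n).endpoint_smul_mem (g n) ((hends n).2 ▸ hmem)
      rwa [closure_smul, smul_inv_smul] at this
  have := Finset.card_le_card_of_injOn f hmaps hf.injOn
  simp at this

end HalfspaceSystem

end CatZero
theorem mainTheorem6 {X : Type*} [MetricSpace X] [ProperSpace X] (hX : IsCAT0 X)
    {G : Type*} [Group G] [MulAction G X] [IsIsometricSMul G X] [ProperlyDiscontinuousSMul G X]
    (hcocompact : ∃ K : Set X, IsCompact K ∧ ⋃ g : G, g • K = univ)
    (𝓗 : HalfspaceSystem X) (hinv : ∀ g : G, ∀ h ∈ 𝓗.carrier, g • h ∈ 𝓗.carrier)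
    (hrho : {ξ : VisualBoundary X | (𝓗.rho ξ).IsPrincipalClass} = ∅) :
    -- `ρ` is well defined: `ρ(ξ)` is the minimum of `ℜ(ξ)`
    (∀ ξ : VisualBoundary X, IsLeast (𝓗.classesAt ξ) (𝓗.rho ξ)) ∧
    (∀ (c : ℝ → X) (hc : Isometry c),
      ¬ 𝓗.rho (forwardRay c hc).endpoint ≤ 𝓗.rho (backwardRay c hc).endpoint ∧
      ¬ 𝓗.rho (backwardRay c hc).endpoint ≤ 𝓗.rho (forwardRay c hc).endpoint) ∧
    (∀ A : Set (VisualBoundary X), IsPiDiscrete A → InjOn 𝓗.rho A) := by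
  have hrho' : ∀ ξ, ¬ (𝓗.rho ξ).IsPrincipalClass := fun ξ h =>
    (hrho ▸ h : ξ ∈ (∅ : Set (VisualBoundary X)))
  refine ⟨HalfspaceSystem.isLeast_rho hX 𝓗, fun c hc => ?_, fun A hA ξ hξ η hη h => ?_⟩
  · have hd : ∀ T t : ℝ≥0, dist ((forwardRay c hc).1 T) ((backwardRay c hc).1 t) = T + t :=
      fun T t => by
        show dist (c T) (c (-t)) = _
        rw [hc.dist_eq, Real.dist_eq, sub_neg_eq_add]
        exact abs_of_nonneg (add_nonneg T.2 t.2)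
    refine ⟨HalfspaceSystem.not_rho_le_rho_of_opposite hX (hrho' _) hd,
      HalfspaceSystem.not_rho_le_rho_of_opposite hX (hrho' _) fun T t => ?_⟩
    rw [dist_comm, hd, add_comm]
  · by_contra hne
    exact HalfspaceSystem.rho_ne_rho hX hcocompact hinv hrho' (hA hξ hη hne) h
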